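/- Let $\lambda$ be a singular cardinal of uncountable cofinality, and let $(\lambda_i)_{i<\operatorname{cof}\lambda}$ be a strictly increasing continuous sequence of cardinals below $\lambda$ which is cofinal in $\lambda$ (continuous means $\lambda_i=\sup_{j<i}\lambda_j$ for every limit ordinal $i<\operatorname{cof}\lambda$). Then there is a closed unbounded subset $C$ of $\operatorname{cof}\lambda$ with the following property. Let $\mathcal F$ be the filter on $\operatorname{cof}\lambda$ generated by the complements of the bounded subsets of $\operatorname{cof}\lambda$ together with the set $C$, and let $\mathcal F_C=\{A\cap C : A\in\mathcal F\}$ be its trace on $C$. Then $\mathcal F_C$ is a nontrivial filter, and the reduced product $\prod_{i\in C}\lambda_i^+/\mathcal F_C$ has true cofinality $\lambda^+$; that is, $\lambda^+$ is regular and there is a sequence $(f_\alpha)_{\alpha<\lambda^+}$ in $\prod_{i\in C}\lambda_i^+$ such that 1. for all $\alpha<\beta<\lambda^+$, $\{i\in C : f_\alpha(i)<f_\beta(i)\}\in\mathcal F_C$; 2. for every $g\in\prod_{i\in C}\lambda_i^+$ there is $\alpha<\lambda^+$ with $\{i\in C : g(i)\le f_\alpha(i)\}\in\mathcal F_C$.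 Here $\mu^+$ is the successor cardinal of $\mu$, and cardinals are identified with initial ordinals. -/

import Mathlib

universe u v w

namespace PCF

/-- The relation `r` compared pointwise modulo `F`, on the reduced product `∏ i, X i / F`:
the classes of `f` and `g` are related iff `{i | r i (f i) (g i)} ∈ F`. -/
def ReducedRel {ι : Type v} (F : Filter ι) {X : ι → Type w} (r : ∀ i, X i → X i → Prop)
    (x y : F.Product X) : Prop :=
  Quotient.liftOn₂ x y (fun f g => ∀ᶠ i in F, r i (f i) (g i)) (by
    intro f₁ g₁ f₂ g₂ hf hg
    refine propext (Filter.eventually_congr ?_)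
    filter_upwards [hf, hg] with i h₁ h₂
    rw [h₁, h₂])

/-- `x ≤ y` in `∏ i, X i / F`: pointwise `≤` on a set belonging to `F`. -/
def ReducedLE {ι : Type v} (F : Filter ι) {X : ι → Type w} [∀ i, LinearOrder (X i)]
    (x y : F.Product X) : Prop :=
  ReducedRel F (fun _ a b => a ≤ b) x y

/-- `x < y` in `∏ i, X i / F`: pointwise `<` on a set belonging to `F`. -/
def ReducedLT {ι : Type v} (F : Filter ι) {X : ι → Type w} [∀ i, LinearOrder (X i)]
    (x y : F.Product X) : Prop :=
  ReducedRel F (fun _ a b => a < b) x y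

/-- The reduced product `∏ i, X i / F` of linear orders, for a nontrivial filter `F`, has true
cofinality the regular cardinal `κ`: it contains a sequence of length `κ` which is strictly
increasing modulo `F` and cofinal. -/
def HasTrueCofinality {ι : Type v} (F : Filter ι) (X : ι → Type w) [∀ i, LinearOrder (X i)]
    (κ : Cardinal.{u}) : Prop :=
  F.NeBot ∧ κ.IsRegular ∧
    ∃ f : Set.Iio κ.ord → F.Product X,
      (∀ α β, α < β → ReducedLT F (f α) (f β)) ∧ ∀ x, ∃ α, ReducedLE F x (f α)

/-- The filter on `α` generated by the complements of the bounded subsets of `α` together with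
the set `C`. -/
def coboundedFilterWith {α : Type v} [LinearOrder α] (C : Set α) : Filter α :=
  Filter.generate ({s | BddAbove sᶜ} ∪ {C})

/-- The filter on the index set `C` given by the traces on `C` of the sets in
`coboundedFilterWith C`. -/
def coboundedFilterOn {α : Type v} [LinearOrder α] (C : Set α) : Filter C :=
  (coboundedFilterWith C).comap Subtype.val

end PCF

namespace PCF
open Cardinal Order Set Filter

/-! ### Cofinality in linear orders and well-orders -/

section WellOrder

variable {α : Type v} [LinearOrder α]

/-! Write θ = cof κ. A recursion builds a sequence F of length κ⁺ in ∏ λ_t⁺, increasing modulo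
bounded sets, which at each δ of infinite cofinality below κ dominates its values along a club of δ
on a single tail of t (`exists_increasing_club_bounded`). Club guessing in K⁺⁺ turns this into
chains of cofinality K that are ordered everywhere on one tail (`exists_uniform_chain`). For regular
K with θ < K < κ, such chains force the projections of F to sets of fewer than K values to stabilise
(`stableProjections_of_clubs`). Stability then gives everything: a least upper bound g exists, g is
exact, and cof g(t) ≥ K eventually. Diagonalising over j yields a club C of limit points t with cof
g(t) ≥ λ_j for all j < t. There λ_t is singular, so g(t) ≥ λ_t⁺, and exactness of g says that F is
cofinal on C. -/

theorem exists_forall_lt_of_mk_lt_cof {s : Set α} (hs : #s < Order.cof α) :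
    ∃ x, ∀ y ∈ s, y < x :=
  not_isCofinal_iff.1 fun h => (cof_le h).not_gt hs

/-- A small family of elements of a linear order has a strict upper bound. -/
theorem exists_forall_lt_of_family {ι : Type v} (hι : #ι < Order.cof α) (g : ι → α) :
    ∃ x, ∀ i, g i < x := by
  obtain ⟨x, hx⟩ := exists_forall_lt_of_mk_lt_cof (mk_range_le.trans_lt hι : #(range g) < _)
  exact ⟨x, fun i => hx _ ⟨i, rfl⟩⟩

/-- A monotone map with few values is eventually constant. -/
theorem exists_forall_ge_eq_of_monotone {β : Type v} [LinearOrder β] {g : α → β} (hg : Monotone g)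
    {s : Set β} (hs : #s < Order.cof α) (hgs : ∀ a, g a ∈ s) :
    ∃ a, ∀ b, a ≤ b → g b = g a := by
  have hU : IsCofinal (⋃ y : s, g ⁻¹' {y.1}) := fun a =>
    ⟨a, mem_iUnion.2 ⟨⟨g a, hgs a⟩, rfl⟩, le_rfl⟩
  obtain ⟨y, hy⟩ := isCofinal_of_isCofinal_iUnion hU hs
  have hne : Nonempty α := by
    rw [← cof_ne_zero_iff]
    exact (pos_of_gt hs).ne'
  obtain ⟨a, ha⟩ := hy.nonempty
  refine ⟨a, fun b hab => ?_⟩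
  obtain ⟨c, hc, hbc⟩ := hy b
  refine le_antisymm ?_ (hg hab)
  rw [show g a = y.1 from ha, ← show g c = y.1 from hc]
  exact hg hbc

/-- An antitone map into a well-order is eventually constant. -/
theorem exists_forall_ge_eq_of_antitone [Nonempty α] {β : Type w} [LinearOrder β]
    [WellFoundedLT β] {g : α → β} (hg : Antitone g) : ∃ a, ∀ b, a ≤ b → g b = g a := by
  obtain ⟨_, ⟨a, rfl⟩, ha⟩ :=
    WellFounded.has_min (wellFounded_lt (α := β)) (range g) (range_nonempty g)
  exact ⟨a, fun b hab => le_antisymm (hg hab) (not_lt.1 (ha _ ⟨b, rfl⟩))⟩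

/-- An unbounded subset of a well-order has as few limit points as elements, so there is a club
whose cardinality is the cofinality. -/
theorem exists_isClub_mk_le_cof [WellFoundedLT α] [NoMaxOrder α] :
    ∃ s : Set α, IsClub s ∧ #s ≤ Order.cof α := by
  obtain ⟨t, ht, hcard⟩ := exists_cof_eq α
  have hgt (x : α) : ∃ y ∈ t, x < y := by
    obtain ⟨x', hx'⟩ := exists_gt x
    obtain ⟨y, hy, hxy⟩ := ht x'
    exact ⟨y, hy, hx'.trans_le hxy⟩
  let s : Set α := {x | ∃ d ⊆ t, d.Nonempty ∧ IsLUB d x}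
  refine ⟨s, ⟨?_, fun a => ?_⟩, ?_⟩
  · intro c hc hc₀ _ a ha
    refine ⟨t ∩ Iic a, inter_subset_left, ?_, fun x hx => hx.2, fun b hb => ha.2 fun x hx => ?_⟩
    · obtain ⟨x, hx⟩ := hc₀
      obtain ⟨d, hd, ⟨y, hy⟩, hdx⟩ := hc hx
      exact ⟨y, hd hy, (hdx.1 hy).trans (ha.1 hx)⟩
    · obtain ⟨d, hd, _, hdx⟩ := hc hx
      exact hdx.2 fun y hy => hb ⟨hd hy, (hdx.1 hy).trans (ha.1 hx)⟩
  · obtain ⟨y, hy, hay⟩ := ht a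
    exact ⟨y, ⟨{y}, singleton_subset_iff.2 hy, singleton_nonempty y, isLUB_singleton⟩, hay⟩
  · rw [← hcard]
    have hwf := wellFounded_lt (α := α)
    -- Send a limit point to the next element of t. If x < x' in s, some y in t has x < y ≤ x', so
    -- this map is strictly increasing.
    let m (x : s) : t := ⟨hwf.min {y | y ∈ t ∧ x.1 < y} (hgt x.1),
      (hwf.min_mem {y | y ∈ t ∧ x.1 < y} (hgt x.1)).1⟩
    have hm : StrictMono m := by
      intro x x' hxx'
      obtain ⟨d, hd, _, hdx⟩ := x'.2
      obtain ⟨y, hy, hxy, hyx⟩ := hdx.exists_between (show x.1 < x'.1 from hxx')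
      have h₁ : (m x).1 ≤ y := not_lt.1 (hwf.not_lt_min {y | y ∈ t ∧ x.1 < y} ⟨hd hy, hxy⟩)
      exact (h₁.trans hyx).trans_lt (hwf.min_mem {y | y ∈ t ∧ x'.1 < y} (hgt x'.1)).2
    exact mk_le_of_injective hm.injective

end WellOrder

/-! ### Regular well-orders and their initial segments -/

section RegularOrders

theorem isRegularCardinalOrder_of_cof_eq {α : Type v} [LinearOrder α] [WellFoundedLT α]
    {K : Cardinal.{v}} (ht : Ordinal.type (α := α) (· < ·) = K.ord) (hc : Order.cof α = K) :
    IsRegularCardinalOrder α :=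
  ⟨by rw [ht, hc]⟩

/-- Every regular cardinal is the order type of a well-order. -/
theorem exists_isRegularCardinalOrder {K : Cardinal.{v}} (hK : K.IsRegular) :
    ∃ (α : Type v) (_ : LinearOrder α) (_ : WellFoundedLT α) (_ : IsRegularCardinalOrder α),
      #α = K :=
  ⟨K.ord.ToType, inferInstance, inferInstance,
    isRegularCardinalOrder_of_cof_eq (K := K) (by simp) (by simp [hK.cof_ord]), by simp⟩

theorem noMaxOrder_of_aleph0_le_cof {α : Type v} [LinearOrder α] (h : ℵ₀ ≤ Order.cof α) :
    NoMaxOrder α := by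
  rw [aleph0_le_cof_iff] at h
  have : Nonempty α := by
    rw [← cof_ne_zero_iff]
    exact (zero_lt_one.trans h).ne'
  rw [← noTopOrder_iff_noMaxOrder]
  exact one_lt_cof_iff.1 h

theorem nonempty_of_aleph0_le_cof {α : Type v} [LinearOrder α] (h : ℵ₀ ≤ Order.cof α) :
    Nonempty α := by
  rw [← cof_ne_zero_iff]
  exact (aleph0_pos.trans_le h).ne'

theorem isSuccLimit_of_aleph0_le_cof_Iio {M : Type v} [LinearOrder M] {b : M} (h : ℵ₀ ≤ Order.cof (Iio b)) :
    IsSuccLimit b := by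
  have := noMaxOrder_of_aleph0_le_cof h
  obtain ⟨c⟩ := nonempty_of_aleph0_le_cof h
  refine ⟨fun hb => hb.not_lt c.2, fun a ha => ?_⟩
  obtain ⟨d, hd⟩ := exists_gt (⟨a, ha.lt⟩ : Iio b)
  exact ha.2 (show a < d.1 from hd) d.2

/-- The trace of a club on an initial segment is a club, as soon as it is unbounded there. -/
theorem IsClub.preimage_val_Iio {M : Type v} [LinearOrder M] {E : Set M} (hE : IsClub E) {a : M}
    (ha : IsCofinal ((↑) ⁻¹' E : Set (Iio a))) : IsClub ((↑) ⁻¹' E : Set (Iio a)) := by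
  refine ⟨fun d hd hd₀ _ x hx => ?_, ha⟩
  refine hE.isLUB_mem (t := (↑) '' d) (image_subset_iff.2 hd) (hd₀.image _) ⟨?_, fun b hb => ?_⟩
  · rintro _ ⟨y, hy, rfl⟩
    exact hx.1 hy
  · by_contra! hbx
    have : x ≤ ⟨b, hbx.trans x.2⟩ := hx.2 fun y hy => hb ⟨y, hy, rfl⟩
    exact hbx.not_ge this

end RegularOrders

/-! ### Club guessing -/

section ClubGuessing

variable {M : Type v} [LinearOrder M] [WellFoundedLT M] [IsRegularCardinalOrder M]

theorem exists_cof_Iio_eq {K : Cardinal.{v}} (hK : K.IsRegular) (hM : K < #M) :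
    ∃ b : M, Order.cof (Iio b) = K := by
  have hlt : K.ord < Ordinal.type (α := M) (· < ·) := by
    rwa [← ord_cardinalMk, ord_lt_ord]
  refine ⟨Ordinal.enum (α := M) (· < ·) ⟨K.ord, hlt⟩, ?_⟩
  rw [Order.cof_Iio, Ordinal.typein_enum, hK.cof_ord]

/-- Every club has a point of prescribed cofinality below which it is unbounded. -/
theorem exists_cof_Iio_eq_isCofinal {K : Cardinal.{v}} (hK : K.IsRegular) (hM : K < #M)
    {E : Set M} (hE : IsClub E) :
    ∃ a : M, Order.cof (Iio a) = K ∧ IsCofinal ((↑) ⁻¹' E : Set (Iio a)) := by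
  obtain ⟨b, hb⟩ := exists_cof_Iio_eq hK hM
  -- The required point is e b with cof b = K: a normal enumeration of E preserves cofinality at
  -- limits.
  let e : M → M := Subtype.val ∘ enum E hE.isCofinal
  have he : IsNormal e := IsClub.isNormal_enum hE
  have hlim : IsSuccLimit b := isSuccLimit_of_aleph0_le_cof_Iio (hb ▸ hK.aleph0_le)
  let e' (x : Iio b) : Iio (e b) := ⟨e x, he.strictMono x.2⟩
  have hcof : IsCofinal (range e') := by
    rintro ⟨y, hy⟩
    obtain ⟨c, hc, hyc⟩ := (he.lt_iff_exists_lt hlim).1 hy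
    exact ⟨_, ⟨⟨c, hc⟩, rfl⟩, hyc.le⟩
  refine ⟨e b, ?_, hcof.mono ?_⟩
  · rw [← hb]
    exact (cof_congr_of_strictMono (f := e') (fun x y h => he.strictMono h) hcof).symm
  · rintro _ ⟨x, rfl⟩
    exact (enum E hE.isCofinal x.1).2

/-- Shelah's club guessing for points of uncountable cofinality `K` in `K⁺⁺`. -/
theorem exists_club_guessing {K : Cardinal.{v}} (hK : K.IsRegular) (hK' : ℵ₀ < K)
    (hM : #M = succ (succ K)) :
    ∃ P : ∀ a : M, Set (Iio a), ∀ D : Set M, IsClub D →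
      ∃ a, Order.cof (Iio a) = K ∧ IsCofinal (P a) ∧ ∀ x ∈ P a, x.1 ∈ D := by
  have hsucc : (succ K).IsRegular := isRegular_succ hK.aleph0_le
  have hcofM : Order.cof M = succ (succ K) := by rw [cof_eq_cardinalMk, hM]
  have hKM : K < #M := hM ▸ (lt_succ K).trans (lt_succ _)
  have hc (a : M) : ∃ e : Set (Iio a), Order.cof (Iio a) = K → IsClub e ∧ #e ≤ K := by
    by_cases ha : Order.cof (Iio a) = K
    · have := noMaxOrder_of_aleph0_le_cof (ha ▸ hK.aleph0_le)
      obtain ⟨e, he, he'⟩ := exists_isClub_mk_le_cof (α := Iio a)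
      exact ⟨e, fun _ => ⟨he, ha ▸ he'⟩⟩
    · exact ⟨∅, fun h => (ha h).elim⟩
  choose e he using hc
  by_contra! hno
  -- If the guesses e a ∩ E fail for every E, then some club D E contains no unbounded e a ∩ E with
  -- cof a = K. Iterate E ↦ D E, with intersections, K⁺ times.
  choose D hD hDa using fun E : Set M => hno fun a => e a ∩ (↑) ⁻¹' E
  obtain ⟨Q, _, _, _, hQ⟩ := exists_isRegularCardinalOrder hsucc
  let E : Q → Set M := (wellFounded_lt (α := Q)).fix fun x rec => ⋂ y : Iio x, D (rec y.1 y.2)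
  have hE (x : Q) : E x = ⋂ y : Iio x, D (E y.1) := WellFounded.fix_eq _ _ x
  have hEclub : IsClub (⋂ x : Q, D (E x)) := by
    refine IsClub.iInter ?_ ?_ fun x => hD _
    · rw [hcofM]
      exact (hK'.trans ((lt_succ K).trans (lt_succ _))).ne'
    · rw [hcofM, hQ]
      simp
  obtain ⟨a, ha, hacof⟩ := exists_cof_Iio_eq_isCofinal hK hKM hEclub
  have hinter : IsCofinal (e a ∩ (↑) ⁻¹' (⋂ x : Q, D (E x)) : Set (Iio a)) :=
    ((he a ha).1.inter (by rw [ha]; exact hK'.ne')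
      (IsClub.preimage_val_Iio hEclub hacof)).isCofinal
  -- Every stage q loses a point of e a. Different stages lose different points, but e a has at most
  -- K of them.
  have hx (q : Q) : ∃ x : e a, x.1.1 ∈ E q ∧ x.1.1 ∉ D (E q) := by
    obtain ⟨x, hx, hx'⟩ := hDa (E q) a ha (hinter.mono fun x hx => ⟨hx.1, by
      rw [mem_preimage, hE]
      exact mem_iInter.2 fun y => mem_iInter.1 hx.2 y.1⟩)
    exact ⟨⟨x, hx.1⟩, hx.2, hx'⟩
  choose x hxE hxD using hx
  have hinj : Function.Injective x := by
    refine Function.Injective.of_lt_imp_ne fun p q hpq h => hxD p ?_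
    have := hxE q
    rw [hE, ← h] at this
    exact mem_iInter.1 this ⟨p, hpq⟩
  exact ((mk_le_of_injective hinj).trans (he a ha).2).not_gt (hQ ▸ lt_succ K)

end ClubGuessing

/-! ### Uniformly increasing chains -/

section Chain

variable {M : Type v} [LinearOrder M] [WellFoundedLT M]
  {L : Type v} [LinearOrder L] [WellFoundedLT L]

/-- For an operation `V` producing few values from initial segments of sequences, there is a normal
sequence whose value at `i` lies strictly above everything that `V` produces from initial segments
ending before `i`. -/
theorem exists_isNormal_closed (hM : ℵ₀ ≤ #M) (hML : #M < Order.cof L)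
    (V : (i : M) → ((c : M) → c ≤ i → L) → M → L) :
    ∃ ξ : M → L, IsNormal ξ ∧ ∀ i j a, j < i → V j (fun c _ => ξ c) a < ξ i := by
  let S (i : M) (rec : (c : M) → c < i → L) : Set L :=
    range (fun j : Iio i => rec j.1 j.2) ∪
      range fun p : Iio i × M => V p.1.1 (fun c hc => rec c (hc.trans_lt p.1.2)) p.2
  have hS (i : M) (rec : (c : M) → c < i → L) : {x | ∀ y ∈ S i rec, y < x}.Nonempty := by
    refine exists_forall_lt_of_mk_lt_cof (lt_of_le_of_lt ?_ hML)
    refine (mk_union_le _ _).trans (add_le_of_le hM (mk_range_le.trans (mk_set_le _)) ?_)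
    refine mk_range_le.trans ?_
    rw [mk_prod, lift_id, lift_id]
    exact mul_le_of_le hM (mk_set_le _) le_rfl
  have hwf := wellFounded_lt (α := L)
  let ξ : M → L := (wellFounded_lt (α := M)).fix fun i rec => hwf.min _ (hS i rec)
  have hξ (i : M) : ξ i = hwf.min _ (hS i fun c _ => ξ c) := WellFounded.fix_eq _ _ i
  have hmem (i : M) : ∀ y ∈ S i fun c _ => ξ c, y < ξ i := by
    rw [hξ]
    exact hwf.min_mem _ (hS i fun c _ => ξ c)
  have hmono : StrictMono ξ := fun j i hji => hmem i _ (Or.inl ⟨⟨j, hji⟩, rfl⟩)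
  have hV : ∀ i j a, j < i → V j (fun c _ => ξ c) a < ξ i := fun i j a hji =>
    hmem i _ (Or.inr ⟨(⟨j, hji⟩, a), rfl⟩)
  refine ⟨ξ, isNormal_iff.2 ⟨hmono, fun i hi b hb => ?_⟩, hV⟩
  rw [hξ]
  refine not_lt.1 (hwf.not_lt_min _ fun y hy => ?_)
  obtain ⟨⟨j, hj⟩, rfl⟩ | ⟨⟨⟨j, hj⟩, a⟩, rfl⟩ := hy <;>
    obtain ⟨k, hjk, hk⟩ := hi.isSuccPrelimit.lt_iff_exists_lt.1 hj
  · exact (hmono hk).trans_le (hb _ hjk)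
  · exact (hV _ _ a hk).trans_le (hb _ hjk)

theorem isClub_range_of_isNormal {N : Type v} [LinearOrder N] {ξ : M → N}
    (hξ : IsNormal ξ) (hcof : IsCofinal (range ξ)) : IsClub (range ξ) := by
  refine ⟨fun d hd hd₀ _ x hx => ?_, hcof⟩
  obtain ⟨_, ⟨i, rfl⟩, hi⟩ := hcof x
  have hne : {k : M | ∀ y ∈ d, y ≤ ξ k}.Nonempty := ⟨i, fun y hy => (hx.1 hy).trans hi⟩
  have hwf := wellFounded_lt (α := M)
  have hk : IsLUB (ξ ⁻¹' d) (hwf.min _ hne) := by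
    refine ⟨fun j hj => hξ.strictMono.le_iff_le.1 (hwf.min_mem _ hne _ hj), fun b hb => ?_⟩
    refine not_lt.1 (hwf.not_lt_min _ fun y hy => ?_)
    obtain ⟨j, rfl⟩ := hd hy
    exact hξ.monotone (hb hy)
  have := hξ.map_isLUB hk (by
    obtain ⟨y, hy⟩ := hd₀
    obtain ⟨j, rfl⟩ := hd hy
    exact ⟨j, hy⟩)
  rw [image_preimage_eq_of_subset hd] at this
  exact ⟨_, this.unique hx⟩

/-- Unboundedness comes from intersecting E with the club `range ξ`, hence the condition cof N ≠ ℵ₀.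
-/
theorem isClub_preimage_of_isNormal {N : Type v} [LinearOrder N] [WellFoundedLT N] {ξ : M → N}
    (hξ : IsNormal ξ) (hcof : IsCofinal (range ξ)) (hN : Order.cof N ≠ ℵ₀) {E : Set N}
    (hE : IsClub E) : IsClub (ξ ⁻¹' E) := by
  refine ⟨fun d hd hd₀ _ x hx => hE.isLUB_mem (image_subset_iff.2 hd) (hd₀.image _)
    (hξ.map_isLUB hx hd₀), fun i => ?_⟩
  obtain ⟨_, ⟨hyE, j, rfl⟩, hy⟩ :=
    (hE.inter hN (isClub_range_of_isNormal hξ hcof)).isCofinal (ξ i)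
  exact ⟨j, hyE, hξ.strictMono.le_iff_le.1 hy⟩

variable {ι : Type v} [LinearOrder ι] [Nonempty ι] {O : Type v} [LinearOrder O]
  [IsRegularCardinalOrder M]

/-- If every point of cofinality `K⁺⁺` has a club on which `f` is bounded uniformly on a tail of
`ι`, then cofinally many pairs `α ≤ n α` can be arranged in a chain of cofinality `K` which is
increasing everywhere on a common tail. -/
theorem exists_uniform_chain {K : Cardinal.{v}} (hK : K.IsRegular) (hK' : ℵ₀ < K)
    (hM : #M = succ (succ K)) (hML : #M < Order.cof L) (hι : #ι < K) {f : L → ι → O}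
    (hf : ∀ α β, α ≤ β → ∀ᶠ t in atTop, f α t ≤ f β t)
    (hclub : ∀ δ : L, Order.cof (Iio δ) = succ (succ K) →
      ∃ E : Set (Iio δ), IsClub E ∧ ∀ᶠ t in atTop, ∀ α ∈ E, f α.1 t ≤ f δ t)
    {n : L → L} (hn : ∀ α, α ≤ n α) :
    ∃ (A : Type v) (_ : LinearOrder A) (u : A → L) (j : ι), Order.cof A = K ∧
      ∀ w w', w < w' → ∀ t, j ≤ t → f (u w) t ≤ f (n (u w)) t ∧ f (n (u w)) t ≤ f (u w') t := by
  have hMinf : ℵ₀ ≤ #M := by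
    rw [hM]
    exact (hK'.trans ((lt_succ K).trans (lt_succ _))).le
  have hcofM : Order.cof M = succ (succ K) := by rw [cof_eq_cardinalMk, hM]
  have hMmax : NoMaxOrder M := noMaxOrder_of_aleph0_le_cof (by rw [hcofM, ← hM]; exact hMinf)
  have hMne : Nonempty M := nonempty_of_aleph0_le_cof (by rw [hcofM, ← hM]; exact hMinf)
  obtain ⟨P, hP⟩ := exists_club_guessing hK hK' hM
  let Bd (Y : Set L) (β : L) : Prop := ∀ᶠ t in atTop, ∀ y ∈ Y, f y t ≤ f β t
  have hb (Y : Set L) : ∃ β, (∃ β, Bd Y β) → Bd Y β := by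
    by_cases h : ∃ β, Bd Y β
    · exact ⟨h.choose, fun _ => h.choose_spec⟩
    · obtain ⟨β⟩ : Nonempty L := by
        rw [← cof_ne_zero_iff]
        exact (pos_of_gt hML).ne'
      exact ⟨β, fun h' => (h h').elim⟩
  choose bd hbd using hb
  let Y (ξ : M → L) (a i : M) : Set L := {y | ∃ c : Iio a, c ∈ P a ∧ c.1 ≤ i ∧ ξ c.1 = y}
  -- The guessed point a is not known yet, so ξ is closed off against all a in M at once.
  obtain ⟨ξ, hξ, hξV⟩ := exists_isNormal_closed hMinf hML fun i rec a =>
    n (bd {y | ∃ c : Iio a, c ∈ P a ∧ ∃ h : c.1 ≤ i, rec c.1 h = y})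
  replace hξV (i j a : M) (hji : j < i) : n (bd (Y ξ a j)) < ξ i := by
    simpa only [exists_prop] using hξV i j a hji
  obtain ⟨δ₀, hδ₀⟩ := exists_forall_lt_of_family hML ξ
  have hwf := wellFounded_lt (α := L)
  have hne : {x | ∀ i, ξ i < x}.Nonempty := ⟨δ₀, hδ₀⟩
  let δ : L := hwf.min _ hne
  have hδ : ∀ i, ξ i < δ := hwf.min_mem _ hne
  let ξ' (i : M) : Iio δ := ⟨ξ i, hδ i⟩
  have hcof : IsCofinal (range ξ') := by
    rintro ⟨x, hx⟩
    have : ¬ ∀ i, ξ i < x := fun h => hwf.not_lt_min {x | ∀ i, ξ i < x} h hx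
    push Not at this
    obtain ⟨i, hi⟩ := this
    exact ⟨_, ⟨i, rfl⟩, hi⟩
  have hξ' : IsNormal ξ' := isNormal_iff.2 ⟨fun i j h => hξ.strictMono h, fun o ho a ha =>
    (hξ.le_iff_forall_le ho).2 fun b hb => ha b hb⟩
  have hcofδ : Order.cof (Iio δ) = succ (succ K) := by
    rw [← cof_congr_of_strictMono hξ'.strictMono hcof, hcofM]
  obtain ⟨E, hE, hEf⟩ := hclub δ hcofδ
  obtain ⟨a, ha, hPa, hPE⟩ := hP _ (isClub_preimage_of_isNormal hξ' hcof (by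
    rw [hcofδ, ← hM]
    exact (hK'.trans (hM ▸ (lt_succ K).trans (lt_succ _))).ne') hE)
  have hamax : NoMaxOrder (Iio a) := noMaxOrder_of_aleph0_le_cof (ha ▸ hK'.le)
  -- Since P a was guessed inside the pulled-back club, δ witnesses that a bound exists. So `bd`,
  -- chosen without reference to δ, is a genuine bound here.
  have hYbd (i : M) : Bd (Y ξ a i) (bd (Y ξ a i)) := by
    refine hbd _ ⟨δ, hEf.mono fun t ht => ?_⟩
    rintro _ ⟨c, hc, _, rfl⟩
    exact ht _ (hPE c hc)
  have hwfa := wellFounded_lt (α := Iio a)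
  have hnext (i : Iio a) : {x | x ∈ P a ∧ i < x}.Nonempty := by
    obtain ⟨i', hi'⟩ := exists_gt i
    obtain ⟨x, hx, hx'⟩ := hPa i'
    exact ⟨x, hx, hi'.trans_le hx'⟩
  let nx (i : Iio a) : Iio a := hwfa.min _ (hnext i)
  let u (i : Iio a) : L := bd (Y ξ a i.1)
  have hj (i : Iio a) : ∃ j, ∀ t, j ≤ t → (∀ y ∈ Y ξ a i.1, f y t ≤ f (u i) t) ∧
      f (u i) t ≤ f (n (u i)) t ∧ f (n (u i)) t ≤ f (ξ (nx i).1) t :=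
    eventually_atTop.1 ((hYbd i.1).and ((hf _ _ (hn _)).and (hf _ _
      (hξV _ _ a (show i.1 < (nx i).1 from (hwfa.min_mem _ (hnext i)).2)).le)))
  choose j hj using hj
  -- There are fewer than K thresholds, so one of them serves cofinally many points of P a.
  have hU : IsCofinal (⋃ k : ι, {x : P a | j x.1 = k}) := by
    exact fun x => ⟨x, mem_iUnion.2 ⟨_, rfl⟩, le_rfl⟩
  obtain ⟨k, hk⟩ := isCofinal_of_isCofinal_iUnion hU
    (by rwa [cof_eq_of_isCofinal hPa, ha])
  refine ⟨{x : P a | j x.1 = k}, inferInstance, fun w => u w.1.1, k, ?_, ?_⟩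
  · rw [cof_eq_of_isCofinal hk, cof_eq_of_isCofinal hPa, ha]
  · rintro ⟨w, hw⟩ ⟨w', hw'⟩ hww' t ht
    have h₁ := hj w.1 t (by rwa [show j w.1 = k from hw])
    have h₂ := hj w'.1 t (by rwa [show j w'.1 = k from hw'])
    -- The successor of w in P a is at most w', so ξ at that successor is among the values bounded
    -- by u w'.
    refine ⟨h₁.2.1, h₁.2.2.trans (h₂.1 _ ⟨nx w.1, (hwfa.min_mem _ (hnext w.1)).1, ?_, rfl⟩)⟩
    exact not_lt.1 (hwfa.not_lt_min {x | x ∈ P a ∧ w.1 < x} ⟨w'.2, hww'⟩)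

end Chain

/-! ### Least upper bounds modulo bounded sets -/

section LeastUpperBound

variable {L ι : Type v} [LinearOrder L] [LinearOrder ι]
  {O : Type v} [ConditionallyCompleteLinearOrderBot O]

theorem eventually_le_of_eventually_lt {f : L → ι → O}
    (hf : ∀ α β, α < β → ∀ᶠ t in atTop, f α t < f β t) (α β : L) (hαβ : α ≤ β) :
    ∀ᶠ t in atTop, f α t ≤ f β t := by
  obtain rfl | h := hαβ.eq_or_lt
  · exact Eventually.of_forall fun t => le_rfl
  · exact (hf α β h).mono fun t ht => ht.le

/-- The projections of `f` to families of fewer than `K` values stabilise modulo bounded sets. -/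
def StableProjections (f : L → ι → O) (K : Cardinal.{v}) : Prop :=
  ∀ x : ι → Set O, (∀ t, #(x t) < K) → (∀ α t, ∃ y ∈ x t, f α t ≤ y) →
    ∃ α, ∀ β, α ≤ β → ∀ᶠ t in atTop,
      sInf {y | y ∈ x t ∧ f β t ≤ y} = sInf {y | y ∈ x t ∧ f α t ≤ y}

/-- Otherwise each α has some n α ≥ α whose projection differs. Along a uniform chain of cofinality
K the projection at each t is monotone with fewer than K values, hence eventually constant, and #ι <
K makes the stage common to all t. The projection at n (u b) is squeezed between two equal ones. -/
theorem stableProjections_of_clubs [WellFoundedLT L] [Nonempty ι] [WellFoundedLT O] {K : Cardinal.{v}} (hK : K.IsRegular) (hK' : ℵ₀ < K)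
    (hL : succ (succ K) < Order.cof L) (hι : #ι < K) {f : L → ι → O}
    (hf : ∀ α β, α ≤ β → ∀ᶠ t in atTop, f α t ≤ f β t)
    (hclub : ∀ δ : L, Order.cof (Iio δ) = succ (succ K) →
      ∃ E : Set (Iio δ), IsClub E ∧ ∀ᶠ t in atTop, ∀ α ∈ E, f α.1 t ≤ f δ t) :
    StableProjections f K := by
  intro x hx hfx
  let p (α : L) (t : ι) : O := sInf {y | y ∈ x t ∧ f α t ≤ y}
  have hpmem (α : L) (t : ι) : p α t ∈ x t := (csInf_mem (hfx α t)).1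
  have hpmono {α β : L} {t : ι} (h : f α t ≤ f β t) : p α t ≤ p β t :=
    csInf_le_csInf' (hfx β t) fun y hy => ⟨hy.1, h.trans hy.2⟩
  by_contra! hno
  choose n hn hn' using hno
  obtain ⟨M, _, _, _, hM⟩ := exists_isRegularCardinalOrder
    (isRegular_succ (isRegular_succ hK.aleph0_le).aleph0_le)
  obtain ⟨A, _, u, j, hA, hu⟩ :=
    exists_uniform_chain (M := M) hK hK' hM (hM ▸ hL) hι hf hclub hn
  have hAmax : NoMaxOrder A := noMaxOrder_of_aleph0_le_cof (hA ▸ hK'.le)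
  have hconst (t : ι) : ∃ a, j ≤ t → ∀ b, a ≤ b → p (u b) t = p (u a) t := by
    by_cases ht : j ≤ t
    · have hmono : Monotone fun a => p (u a) t := by
        intro a b hab
        obtain rfl | hab := hab.eq_or_lt
        · exact le_rfl
        · exact hpmono ((hu a b hab t ht).1.trans (hu a b hab t ht).2)
      obtain ⟨a, ha⟩ := exists_forall_ge_eq_of_monotone hmono (s := x t) (hA ▸ hx t)
        fun a => hpmem _ _
      exact ⟨a, fun _ => ha⟩
    · obtain ⟨a⟩ := nonempty_of_aleph0_le_cof (hA ▸ hK'.le)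
      exact ⟨a, fun h => (ht h).elim⟩
  choose a ha using hconst
  obtain ⟨b, hb⟩ := exists_forall_lt_of_family (hA ▸ hι) a
  obtain ⟨c, hc⟩ := exists_gt b
  refine hn' (u b) (eventually_atTop.2 ⟨j, fun t ht => ?_⟩)
  have h := hu b c hc t ht
  refine not_ne_iff.2 (le_antisymm ?_ (hpmono h.1) : p (n (u b)) t = p (u b) t)
  calc p (n (u b)) t ≤ p (u c) t := hpmono h.2
    _ = p (u b) t := by rw [ha t ht c ((hb t).le.trans hc.le), ha t ht b (hb t).le]

variable {f : L → ι → O} {H g : ι → O}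

/-- An increasing family whose projections stabilise has a least upper bound modulo bounded sets. -/
theorem exists_least_upper_bound [WellFoundedLT O] {K : Cardinal.{v}} (hK : K.IsRegular) (hι : #ι < K)
    (hKL : K < Order.cof L) (hf : ∀ α β, α ≤ β → ∀ᶠ t in atTop, f α t ≤ f β t)
    (hH : ∀ α t, f α t ≤ H t) (hstab : StableProjections f K) :
    ∃ g : ι → O, (∀ t, g t ≤ H t) ∧ (∀ α, ∀ᶠ t in atTop, f α t ≤ g t) ∧
      ∀ g' : ι → O, (∀ α, ∀ᶠ t in atTop, f α t ≤ g' t) → ∀ᶠ t in atTop, g t ≤ g' t := by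
  suffices h : ∃ g : ι → O, (∀ α, ∀ᶠ t in atTop, f α t ≤ g t) ∧
      ∀ g' : ι → O, (∀ α, ∀ᶠ t in atTop, f α t ≤ g' t) → ∀ᶠ t in atTop, g t ≤ g' t by
    obtain ⟨g, hg, hg'⟩ := h
    exact ⟨fun t => min (g t) (H t), fun t => min_le_right _ _,
      fun α => (hg α).mono fun t ht => le_min ht (hH α t),
      fun g' h => (hg' g' h).mono fun t ht => (min_le_left _ _).trans ht⟩
  by_contra! hno
  have hΦ (g : ι → O) : ∃ g' : ι → O, (∀ α, ∀ᶠ t in atTop, f α t ≤ g t) →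
      (∀ α, ∀ᶠ t in atTop, f α t ≤ g' t) ∧ ¬ ∀ᶠ t in atTop, g t ≤ g' t := by
    by_cases hg : ∀ α, ∀ᶠ t in atTop, f α t ≤ g t
    · obtain ⟨g', h, h'⟩ := hno g hg
      exact ⟨g', fun _ => ⟨h, fun h'' => h' (h''.mono fun t ht => not_lt.2 ht)⟩⟩
    · exact ⟨g, fun h => (hg h).elim⟩
  choose Φ hΦ using hΦ
  obtain ⟨Q, _, _, _, hQ⟩ := exists_isRegularCardinalOrder hK
  have hcofQ : Order.cof Q = K := by rw [cof_eq_cardinalMk, hQ]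
  have hQmax : NoMaxOrder Q := noMaxOrder_of_aleph0_le_cof (hcofQ ▸ hK.aleph0_le)
  have hQne : Nonempty Q := nonempty_of_aleph0_le_cof (hcofQ ▸ hK.aleph0_le)
  have hIio (ξ : Q) : #(Iio ξ) < K := by
    have h := Ordinal.typein_lt_type (α := Q) (· < ·) ξ
    rw [← ord_cardinalMk, hQ, lt_ord, Ordinal.card_typein] at h
    exact h
  let pr (x : ι → Set O) (α : L) (t : ι) : O := sInf {y | y ∈ x t ∧ f α t ≤ y}
  have hst (x : ι → Set O) : ∃ α, (∀ t, #(x t) < K) → (∀ t, H t ∈ x t) →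
      ∀ β, α ≤ β → ∀ᶠ t in atTop, pr x β t = pr x α t := by
    by_cases h : (∀ t, #(x t) < K) ∧ ∀ t, H t ∈ x t
    · obtain ⟨α, hα⟩ := hstab x h.1 fun α t => ⟨H t, h.2 t, hH α t⟩
      exact ⟨α, fun _ _ => hα⟩
    · obtain ⟨α⟩ : Nonempty L := by
        rw [← cof_ne_zero_iff]
        exact (pos_of_gt hKL).ne'
      exact ⟨α, fun h₁ h₂ => (h ⟨h₁, h₂⟩).elim⟩
  choose st hst using hst
  -- Stage ξ projects to H and the earlier upper bounds G η; Φ then refutes the minimality of the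
  -- resulting bound g ξ.
  let X (ξ : Q) (G : (η : Q) → η < ξ → ι → O) (t : ι) : Set O :=
    insert (H t) (range fun η : Iio ξ => G η.1 η.2 t)
  let G : Q → ι → O := (wellFounded_lt (α := Q)).fix fun ξ rec =>
    Φ (pr (X ξ rec) (st (X ξ rec)))
  let x (ξ : Q) : ι → Set O := X ξ fun η _ => G η
  let g (ξ : Q) : ι → O := pr (x ξ) (st (x ξ))
  have hG (ξ : Q) : G ξ = Φ (g ξ) := WellFounded.fix_eq _ _ ξ
  have hxH (ξ : Q) (t : ι) : H t ∈ x ξ t := mem_insert _ _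
  have hxcard (ξ : Q) (t : ι) : #(x ξ t) < K :=
    (mk_insert_le).trans_lt (add_lt_of_lt hK.aleph0_le (mk_range_le.trans_lt (hIio ξ))
      (one_lt_aleph0.trans_le hK.aleph0_le))
  have hle (ξ : Q) (α : L) (t : ι) : f α t ≤ pr (x ξ) α t :=
    (csInf_mem (s := {y | y ∈ x ξ t ∧ f α t ≤ y}) ⟨H t, hxH ξ t, hH α t⟩).2
  have hub (ξ : Q) (α : L) : ∀ᶠ t in atTop, f α t ≤ g ξ t := by
    filter_upwards [hst (x ξ) (hxcard ξ) (hxH ξ) (max α (st (x ξ))) (le_max_right _ _),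
      hf α (max α (st (x ξ))) (le_max_left _ _)] with t h₁ h₂
    exact h₂.trans ((hle ξ _ t).trans h₁.le)
  -- K < cof L puts one α beyond all stabilisation indices. At this α the projections decrease with
  -- ξ, so they stop at a stage common to all t, after which adding G ξ changes nothing.
  obtain ⟨α, hα⟩ := exists_forall_lt_of_family (show #Q < Order.cof L by rwa [hQ])
    fun ξ => st (x ξ)
  have hanti (t : ι) : Antitone fun ξ => pr (x ξ) α t := by
    intro ξ ξ' hξ
    refine csInf_le_csInf' ⟨H t, hxH ξ t, hH α t⟩ fun y hy => ⟨?_, hy.2⟩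
    obtain h | ⟨η, rfl⟩ := hy.1
    · exact Or.inl h
    · exact Or.inr ⟨⟨η.1, η.2.trans_le hξ⟩, rfl⟩
  choose c hc using fun t => exists_forall_ge_eq_of_antitone (hanti t)
  obtain ⟨ξ, hξ⟩ := exists_forall_lt_of_family (show #ι < Order.cof Q by rwa [hcofQ]) c
  obtain ⟨ξ', hξ'⟩ := exists_gt ξ
  have hΦξ := hΦ (g ξ) (hub ξ)
  refine hΦξ.2 ?_
  filter_upwards [hst (x ξ) (hxcard ξ) (hxH ξ) α (hα ξ).le, hΦξ.1 α] with t h₁ h₂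
  calc g ξ t = pr (x ξ) α t := h₁.symm
    _ = pr (x ξ') α t := by rw [hc t ξ (hξ t).le, hc t ξ' ((hξ t).le.trans hξ'.le)]
    _ ≤ Φ (g ξ) t := csInf_le' ⟨Or.inr ⟨⟨ξ, hξ'⟩, congrFun (hG ξ) t⟩, h₂⟩

/-- A least upper bound of a family whose projections stabilise is exact. -/
theorem exists_lt_of_lt_least_upper_bound {K : Cardinal.{v}} (hK : ℵ₀ ≤ K)
    (hf : ∀ α β, α ≤ β → ∀ᶠ t in atTop, f α t ≤ f β t)
    (hH : ∀ α t, f α t ≤ H t) (hstab : StableProjections f K)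
    (hub : ∀ α, ∀ᶠ t in atTop, f α t ≤ g t)
    (hg : ∀ g' : ι → O, (∀ α, ∀ᶠ t in atTop, f α t ≤ g' t) → ∀ᶠ t in atTop, g t ≤ g' t)
    {h : ι → O} (hh : ∀ᶠ t in atTop, h t < g t) (hhH : ∀ t, h t < H t) :
    ∃ α, ∀ᶠ t in atTop, h t ≤ f α t := by
  have hpr (α : L) (t : ι) :
      sInf {y | y ∈ ({h t, H t} : Set O) ∧ f α t ≤ y} = if f α t ≤ h t then h t else H t := by
    split_ifs with hle
    · refine IsLeast.csInf_eq ⟨⟨Or.inl rfl, hle⟩, ?_⟩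
      rintro y ⟨rfl | rfl, -⟩
      exacts [le_rfl, (hhH t).le]
    · refine IsLeast.csInf_eq ⟨⟨Or.inr rfl, hH α t⟩, ?_⟩
      rintro y ⟨rfl | rfl, h'⟩
      exacts [(hle h').elim, le_rfl]
  obtain ⟨α, hα⟩ := hstab (fun t => {h t, H t})
    (fun t => ((finite_singleton _).insert _).lt_aleph0.trans_le hK)
    fun α t => ⟨H t, Or.inr rfl, hH α t⟩
  simp only [hpr] at hα
  -- Stability of the projection to {h, H} means that where f α ≤ h, later f β stay below h too. So
  -- lowering g to h there leaves an upper bound.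
  have := hg (fun t => if f α t ≤ h t then h t else g t) fun β => by
    filter_upwards [hf β (max α β) (le_max_right _ _), hα (max α β) (le_max_left _ _),
      hub β] with t h₁ h₂ h₃
    split_ifs with hle
    · rw [if_pos hle] at h₂
      split_ifs at h₂ with hle'
      · exact h₁.trans hle'
      · exact ((hhH t).ne h₂.symm).elim
    · exact h₃
  refine ⟨α, ?_⟩
  filter_upwards [this, hh] with t h₁ h₂
  by_contra! hlt
  rw [if_pos hlt.le] at h₁
  exact h₁.not_gt h₂

/-- The values of a least upper bound of a strictly increasing family eventually have cofinality
at least `K`, if projections to fewer than `K` values stabilise. -/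
theorem eventually_le_cof_least_upper_bound [NoMaxOrder L] [WellFoundedLT O]
    {K : Cardinal.{v}} (hK : ℵ₀ ≤ K)
    (hf : ∀ α β, α < β → ∀ᶠ t in atTop, f α t < f β t)
    (hH : ∀ α t, f α t ≤ H t) (hstab : StableProjections f K)
    (hub : ∀ α, ∀ᶠ t in atTop, f α t ≤ g t)
    (hg : ∀ g' : ι → O, (∀ α, ∀ᶠ t in atTop, f α t ≤ g' t) → ∀ᶠ t in atTop, g t ≤ g' t) :
    ∀ᶠ t in atTop, K ≤ Order.cof (Iio (g t)) := by
  have hlt (α : L) : ∀ᶠ t in atTop, f α t < g t := by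
    obtain ⟨β, hβ⟩ := exists_gt α
    filter_upwards [hf α β hβ, hub β] with t h₁ h₂ using h₁.trans_le h₂
  choose s hs hscard using fun t => exists_cof_eq (Iio (g t))
  -- Where cof g(t) < K, project to a small cofinal subset of g(t): the projection falls below g(t),
  -- yet remains an upper bound. H t keeps the projection defined.
  let x (t : ι) : Set O :=
    insert (H t) {y | Order.cof (Iio (g t)) < K ∧ y ∈ Subtype.val '' s t}
  have hx (t : ι) : #(x t) < K := by
    refine mk_insert_le.trans_lt (add_lt_of_lt hK ?_ (one_lt_aleph0.trans_le hK))
    by_cases h : Order.cof (Iio (g t)) < K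
    · refine (mk_le_mk_of_subset fun y hy => hy.2).trans_lt ?_
      exact mk_image_le.trans_lt (hscard t ▸ h)
    · simpa [h] using aleph0_pos.trans_le hK
  have hne (α : L) (t : ι) : ∃ y ∈ x t, f α t ≤ y := ⟨H t, Or.inl rfl, hH α t⟩
  obtain ⟨α, hα⟩ := hstab x hx hne
  have hpr {t : ι} (h : Order.cof (Iio (g t)) < K) (hα : f α t < g t) :
      sInf {y | y ∈ x t ∧ f α t ≤ y} < g t := by
    obtain ⟨y, hy, hαy⟩ := hs t (⟨f α t, hα⟩ : Iio (g t))
    have hmem : y.1 ∈ {y | y ∈ x t ∧ f α t ≤ y} := ⟨Or.inr ⟨h, y, hy, rfl⟩, hαy⟩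
    exact (csInf_le' hmem).trans_lt y.2
  classical
  have := hg (fun t => if Order.cof (Iio (g t)) < K then sInf {y | y ∈ x t ∧ f α t ≤ y} else g t)
    fun β => by
      filter_upwards [hub β, hα (max α β) (le_max_left _ _),
        eventually_le_of_eventually_lt hf β (max α β) (le_max_right _ _)] with t h₁ h₂ h₃
      split_ifs with hlt
      · rw [← h₂]
        exact h₃.trans (csInf_mem (hne _ t)).2
      · exact h₁
  filter_upwards [this, hlt α] with t h₁ h₂
  by_contra! hcof
  rw [if_pos hcof] at h₁
  exact h₁.not_gt (hpr hcof h₂)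

end LeastUpperBound

/-! ### Closure points and recursive families -/

section Construction

/-- The limit points closed under a function form a club. -/
theorem isClub_closure_points {M : Type v} [LinearOrder M] [WellFoundedLT M]
    [IsRegularCardinalOrder M] (hM : ℵ₀ < #M) (b : M → M) (a₀ : M) :
    IsClub {t | a₀ < t ∧ IsSuccLimit t ∧ ∀ j < t, b j ≤ t} := by
  have hwf := wellFounded_lt (α := M)
  have hcof : Order.cof M = #M := cof_eq_cardinalMk
  refine ⟨fun d hd hd₀ _ x hx => ?_, fun a => ?_⟩
  · refine ⟨?_, ?_, fun j hj => ?_⟩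
    · obtain ⟨y, hy⟩ := hd₀
      exact (hd hy).1.trans_le (hx.1 hy)
    · by_cases hxd : x ∈ d
      · exact (hd hxd).2.1
      · exact hx.isSuccLimit_of_notMem hd₀ hxd
    · obtain ⟨y, hy, hjy, hyx⟩ := hx.exists_between hj
      exact ((hd hy).2.2 j hjy).trans hyx
  · have hIic (x : M) : #(Iic x) < #M := by
      rw [← Iio_insert]
      refine mk_insert_le.trans_lt (add_lt_of_lt hM.le ?_ (one_lt_aleph0.trans hM))
      have h := Ordinal.typein_lt_type (α := M) (· < ·) x
      rw [← ord_cardinalMk, lt_ord, Ordinal.card_typein] at h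
      exact h
    have hs (x : M) : ∃ y, x < y ∧ ∀ j ≤ x, b j < y := by
      have : #(insert x (b '' Iic x) : Set M) < Order.cof M := by
        rw [hcof]
        exact mk_insert_le.trans_lt (add_lt_of_lt hM.le (mk_image_le.trans_lt (hIic x))
          (one_lt_aleph0.trans hM))
      obtain ⟨y, hy⟩ := exists_forall_lt_of_mk_lt_cof this
      exact ⟨y, hy x (Or.inl rfl), fun j hj => hy _ (Or.inr ⟨j, hj, rfl⟩)⟩
    choose s hs hs' using hs
    -- The supremum of an ω-sequence of closure steps is a limit closed under b.
    let x (n : ℕ) : M := s^[n] (max a a₀)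
    have hx (n : ℕ) : x (n + 1) = s (x n) := Function.iterate_succ_apply' s n _
    have hlt (n : ℕ) : x n < x (n + 1) := hx n ▸ hs _
    have hne : (upperBounds (range x)).Nonempty := by
      obtain ⟨y, hy⟩ := exists_forall_lt_of_mk_lt_cof (s := range x)
        (hcof ▸ ((countable_range x).le_aleph0.trans_lt hM))
      exact ⟨y, fun z hz => (hy z hz).le⟩
    have hlub : IsLUB (range x) (hwf.min _ hne) :=
      ⟨hwf.min_mem _ hne, fun z hz => not_lt.1 (hwf.not_lt_min _ hz)⟩
    have hle (n : ℕ) : x n < hwf.min _ hne := (hlt n).trans_le (hlub.1 ⟨n + 1, rfl⟩)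
    refine ⟨_, ⟨(le_max_right a a₀).trans_lt (hle 0), ?_, fun j hj => ?_⟩,
      (le_max_left a a₀).trans (hle 0).le⟩
    · refine hlub.isSuccLimit_of_notMem (range_nonempty x) ?_
      rintro ⟨n, hn⟩
      exact (hle n).ne hn
    · obtain ⟨_, ⟨n, rfl⟩, hjn, -⟩ := hlub.exists_between hj
      exact ((hs' (x n) j hjn.le).trans_eq (hx n).symm).le.trans (hle _).le

/-- Recursive construction of a family of functions below `H` in which `F δ t` exceeds `F α t`
for each of the few `α` in `A δ t`. -/
theorem exists_family_above {L ι O : Type v} [LinearOrder L] [WellFoundedLT L] [LinearOrder O]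
    (H : ι → O) (A : L → ι → Set L) (hA : ∀ δ t, ∀ α ∈ A δ t, α < δ)
    (hcard : ∀ δ t, #(A δ t) < Order.cof (Iio (H t))) :
    ∃ F : L → (t : ι) → Iio (H t), ∀ δ t, ∀ α ∈ A δ t, F α t < F δ t := by
  have hex (δ : L) (rec : (α : L) → α < δ → (t : ι) → Iio (H t)) (t : ι) :
      ∃ x : Iio (H t), ∀ α : A δ t, rec α.1 (hA δ t α.1 α.2) t < x :=
    exists_forall_lt_of_family (hcard δ t) _
  let F : L → (t : ι) → Iio (H t) := (wellFounded_lt (α := L)).fix fun δ rec t =>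
    (hex δ rec t).choose
  have hF (δ : L) : F δ = fun t => (hex δ (fun α _ => F α) t).choose := WellFounded.fix_eq _ _ δ
  refine ⟨F, fun δ t α hα => ?_⟩
  rw [hF δ]
  exact (hex δ (fun α _ => F α) t).choose_spec ⟨α, hα⟩

end Construction

/-! ### Regular cardinals as sets of ordinals -/

section Ordinals

theorem cof_Iio_ord {K : Cardinal.{u}} (hK : K.IsRegular) :
    Order.cof (Iio K.ord) = Cardinal.lift.{u + 1} K := by
  rw [Ordinal.cof_Iio, ← Ordinal.lift_cof, hK.cof_ord]

theorem mk_Iio_ord (K : Cardinal.{u}) : #(Iio K.ord) = Cardinal.lift.{u + 1} K := by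
  rw [mk_Iio_ordinal, card_ord]

theorem isRegularCardinalOrder_Iio_ord {K : Cardinal.{u}} (hK : K.IsRegular) :
    IsRegularCardinalOrder (Iio K.ord) :=
  isRegularCardinalOrder_of_cof_eq (K := Cardinal.lift.{u + 1} K) (by simp) (cof_Iio_ord hK)

end Ordinals

/-! ### The increasing sequence and its cofinality on a club -/

theorem eventually_le_of_cofinal {κ : Cardinal.{u}} {ι : Type (u + 1)} [LinearOrder ι]
    {lam : ι → Cardinal.{u}} (hlam : Monotone lam) (hlam' : ∀ μ < κ, ∃ i, μ ≤ lam i)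
    {μ : Cardinal.{u}} (hμ : μ < κ) : ∀ᶠ t in atTop, μ ≤ lam t := by
  obtain ⟨i, hi⟩ := hlam' μ hμ
  exact (eventually_ge_atTop i).mono fun t ht => hi.trans (hlam ht)

/-- In `∏ lam t⁺` there is an increasing sequence of length `κ⁺`, modulo bounded sets, which at
limit points dominates uniformly its values on a club. -/
theorem exists_increasing_club_bounded {κ : Cardinal.{u}} (hκ : IsSuccLimit κ) (hκ' : ℵ₀ < κ)
    {ι : Type (u + 1)} [LinearOrder ι]
    {lam : ι → Cardinal.{u}} (hlam : Monotone lam) (hlam' : ∀ μ < κ, ∃ i, μ ≤ lam i) :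
    ∃ F : Iio (succ κ).ord → (t : ι) → Iio (succ (lam t)).ord,
      (∀ α β, α < β → ∀ᶠ t in atTop, F α t < F β t) ∧
      ∀ (K : Cardinal.{u}) (δ : Iio (succ κ).ord), ℵ₀ ≤ K → K < κ →
        Order.cof (Iio δ) = Cardinal.lift.{u + 1} K →
        ∃ E : Set (Iio δ), IsClub E ∧ ∀ᶠ t in atTop, ∀ α ∈ E, F α.1 t < F δ t := by
  have hev {μ : Cardinal.{u}} (hμ : μ < κ) := eventually_le_of_cofinal hlam hlam' hμ
  have hr (δ : Iio (succ κ).ord) : Nonempty (Iio δ ↪ Iio κ.ord) := by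
    refine (?_ : #(Iio δ) ≤ #(Iio κ.ord))
    rw [mk_Iio_ord]
    have hinj : Function.Injective fun x : Iio δ => (⟨x.1.1, x.2⟩ : Iio δ.1) := by
      intro x y h
      simpa [Subtype.ext_iff] using h
    refine (mk_le_of_injective hinj).trans ?_
    rw [mk_Iio_ordinal, Cardinal.lift_le]
    exact lt_succ_iff.1 (lt_ord.1 δ.2)
  have he (δ : Iio (succ κ).ord) : ∃ e : Set (Iio δ), ℵ₀ ≤ Order.cof (Iio δ) →
      IsClub e ∧ #e ≤ Order.cof (Iio δ) := by
    by_cases h : ℵ₀ ≤ Order.cof (Iio δ)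
    · have := noMaxOrder_of_aleph0_le_cof h
      obtain ⟨e, he⟩ := exists_isClub_mk_le_cof (α := Iio δ)
      exact ⟨e, fun _ => he⟩
    · exact ⟨∅, fun h' => (h h').elim⟩
  choose e he using he
  let r (δ : Iio (succ κ).ord) : Iio δ ↪ Iio κ.ord := (hr δ).some
  -- At coordinate t only about λ_t predecessors can be dominated: those of rank below λ_t in an
  -- injection of δ into κ, and the whole club e δ once it is small enough. Each α < δ enters
  -- eventually.
  let A (δ : Iio (succ κ).ord) (t : ι) : Set (Iio (succ κ).ord) :=
    {α | ℵ₀ ≤ lam t ∧ α ∈ Subtype.val '' ({x | (r δ x).1 < (lam t).ord} ∪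
      {x | x ∈ e δ ∧ #(e δ) ≤ Cardinal.lift.{u + 1} (lam t)})}
  have hA : ∀ δ t, ∀ α ∈ A δ t, α < δ := by
    rintro δ t _ ⟨-, x, -, rfl⟩
    exact x.2
  have hcard (δ : Iio (succ κ).ord) (t : ι) :
      #(A δ t) < Order.cof (Iio (succ (lam t)).ord) := by
    by_cases hinf : ℵ₀ ≤ lam t
    · have hinf' : ℵ₀ ≤ Cardinal.lift.{u + 1} (lam t) := by simpa
      rw [cof_Iio_ord (isRegular_succ hinf)]
      refine lt_of_le_of_lt ?_ (Cardinal.lift_lt.2 (lt_succ (lam t)))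
      refine (mk_le_mk_of_subset fun x hx => hx.2).trans (mk_image_le.trans ?_)
      refine (mk_union_le _ _).trans (add_le_of_le hinf' ?_ ?_)
      · rw [← mk_Iio_ord]
        have hinj : Function.Injective fun x : {x | (r δ x).1 < (lam t).ord} =>
            (⟨(r δ x.1).1, x.2⟩ : Iio (lam t).ord) := by
          intro x y h
          exact Subtype.ext ((r δ).injective (Subtype.ext (congrArg (fun z => z.1) h)))
        exact mk_le_of_injective hinj
      · by_cases hle : #(e δ) ≤ Cardinal.lift.{u + 1} (lam t)
        · exact (mk_le_mk_of_subset fun x hx => hx.1).trans hle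
        · simp [hle]
    · have : A δ t = ∅ := eq_empty_of_forall_notMem fun x hx => hinf hx.1
      rw [this, mk_eq_zero, pos_iff_ne_zero, cof_ne_zero_iff]
      exact ⟨⟨0, ord_pos.2 (succ_pos _)⟩⟩
  obtain ⟨F, hF⟩ := exists_family_above (fun t => (succ (lam t)).ord) A hA hcard
  refine ⟨F, fun α β hαβ => ?_, fun K δ hK hKκ hδ => ?_⟩
  · have hlt : (r β ⟨α, hαβ⟩).1.card < κ := lt_ord.1 (r β ⟨α, hαβ⟩).2
    filter_upwards [hev hκ', hev (hκ.succ_lt hlt)] with t h₁ h₂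
    exact hF β t α ⟨h₁, ⟨α, hαβ⟩, Or.inl (lt_ord.2 (succ_le_iff.1 h₂)), rfl⟩
  · have hclub := he δ (by rw [hδ]; simpa)
    refine ⟨e δ, hclub.1, ?_⟩
    filter_upwards [hev hκ', hev hKκ] with t h₁ h₂ α hα
    refine hF δ t α.1 ⟨h₁, α, Or.inr ⟨hα, hclub.2.trans ?_⟩, rfl⟩
    rw [hδ]
    exact Cardinal.lift_le.2 h₂

theorem cof_Iio_ord_le_of_isNormal {ι : Type (u + 1)} [LinearOrder ι] {lam : ι → Cardinal.{u}}
    (hlam : IsNormal lam) {t : ι} (ht : IsSuccLimit t) :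
    Order.cof (Iio (lam t).ord) ≤ #ι := by
  have hlt (j : Iio t) : (lam j.1).ord < (lam t).ord := ord_lt_ord.2 (hlam.strictMono j.2)
  have hcof : IsCofinal (range fun j : Iio t => (⟨(lam j.1).ord, hlt j⟩ : Iio (lam t).ord)) := by
    rintro ⟨x, hx⟩
    obtain ⟨j, hj, hxj⟩ := (hlam.lt_iff_exists_lt ht).1 (lt_ord.1 hx)
    exact ⟨_, ⟨⟨j, hj⟩, rfl⟩, (lt_ord.2 hxj).le⟩
  exact (cof_le hcof).trans (mk_range_le.trans (mk_set_le _))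

/-- At a limit `t` with `lam t` singular, an ordinal whose cofinality is at least `lam j` for all
`j < t` is at least `(lam t)⁺`. -/
theorem succ_ord_le_of_le_cof {ι : Type (u + 1)} [LinearOrder ι] {lam : ι → Cardinal.{u}}
    (hlam : IsNormal lam) {t : ι} (ht : IsSuccLimit t)
    (hι : #ι < Cardinal.lift.{u + 1} (lam t)) {o : Ordinal.{u}}
    (ho : ∀ j < t, Cardinal.lift.{u + 1} (lam j) ≤ Order.cof (Iio o)) :
    (succ (lam t)).ord ≤ o := by
  by_contra! hlt
  have hcof : Order.cof (Iio o) = Cardinal.lift.{u + 1} o.cof := by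
    rw [Ordinal.cof_Iio, Ordinal.lift_cof]
  have h₁ : o.cof ≤ lam t := (Ordinal.cof_le_card o).trans (lt_succ_iff.1 (lt_ord.1 hlt))
  have h₂ : lam t ≤ o.cof := (hlam.le_iff_forall_le ht).2 fun j hj => by
    exact Cardinal.lift_le.1 (hcof ▸ ho j hj)
  -- Now cof o = λ_t, so λ_t would be regular; by continuity its cofinality is at most #ι < λ_t.
  have h₃ : (lam t).ord.cof = lam t := by
    rw [← h₁.antisymm h₂, Ordinal.cof_ord_cof]
  have h₄ := cof_Iio_ord_le_of_isNormal hlam ht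
  rw [Ordinal.cof_Iio, ← Ordinal.lift_cof, h₃] at h₄
  exact h₄.not_gt hι

/-- Along a club, the increasing sequence is cofinal. -/
theorem exists_club_cofinal {κ : Cardinal.{u}} (hκ : κ.IsSingular)
    (hcof : ℵ₀ < κ.ord.cof) {lam : Iio κ.ord.cof.ord → Cardinal.{u}}
    (hlam : IsNormal lam) (hlam' : ∀ i, lam i < κ) (hlam'' : ∀ μ < κ, ∃ i, μ ≤ lam i) :
    ∃ C : Set (Iio κ.ord.cof.ord), IsClub C ∧
      ∃ F : Iio (succ κ).ord → (t : Iio κ.ord.cof.ord) → Iio (succ (lam t)).ord,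
        (∀ α β, α < β → ∀ᶠ t in atTop, F α t < F β t) ∧
        ∀ h : (t : Iio κ.ord.cof.ord) → Iio (succ (lam t)).ord,
          ∃ α, ∀ᶠ t in atTop, t ∈ C → h t ≤ F α t := by
  have hlim := hκ.isSuccLimit
  have hθ : κ.ord.cof.IsRegular := ⟨hcof.le, (Ordinal.cof_ord_cof _).ge⟩
  have hθκ : κ.ord.cof < κ := hκ.cof_ord_lt
  have hreg : (succ κ).IsRegular := isRegular_succ hκ.aleph0_le
  obtain ⟨F, hF, hFclub⟩ :=
    exists_increasing_club_bounded hlim (hcof.trans hθκ) hlam.monotone hlam''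
  have hLcof : Order.cof (Iio (succ κ).ord) = Cardinal.lift.{u + 1} (succ κ) := cof_Iio_ord hreg
  have hLmax : NoMaxOrder (Iio (succ κ).ord) :=
    noMaxOrder_of_aleph0_le_cof (hLcof ▸ Cardinal.aleph0_le_lift.2 hreg.aleph0_le)
  have hιcard : #(Iio κ.ord.cof.ord) = Cardinal.lift.{u + 1} κ.ord.cof := mk_Iio_ord _
  have hιreg : IsRegularCardinalOrder (Iio κ.ord.cof.ord) := isRegularCardinalOrder_Iio_ord hθ
  have hιne : Nonempty (Iio κ.ord.cof.ord) :=
    nonempty_of_aleph0_le_cof (cof_Iio_ord hθ ▸ Cardinal.aleph0_le_lift.2 hcof.le)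
  let f (α : Iio (succ κ).ord) (t : Iio κ.ord.cof.ord) : Ordinal.{u} := (F α t).1
  let H (t : Iio κ.ord.cof.ord) : Ordinal.{u} := (succ (lam t)).ord
  have hf : ∀ α β, α < β → ∀ᶠ t in atTop, f α t < f β t := hF
  have hf' := eventually_le_of_eventually_lt hf
  have hfH (α : Iio (succ κ).ord) (t : Iio κ.ord.cof.ord) : f α t ≤ H t := (F α t).2.le
  have hstab {K : Cardinal.{u}} (hK : K.IsRegular) (hθK : κ.ord.cof < K) (hKκ : K < κ) :
      StableProjections f (Cardinal.lift.{u + 1} K) := by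
    refine stableProjections_of_clubs hK.lift (by simpa using hcof.trans hθK) ?_ ?_ hf' ?_
    · rw [hLcof, ← lift_succ, ← lift_succ, Cardinal.lift_lt]
      exact (hlim.succ_lt (hlim.succ_lt hKκ)).trans (lt_succ κ)
    · rwa [hιcard, Cardinal.lift_lt]
    · intro δ hδ
      rw [← lift_succ, ← lift_succ] at hδ
      obtain ⟨E, hE, hEF⟩ := hFclub _ δ
        ((hcof.trans hθK).le.trans ((le_succ _).trans (le_succ _)))
        (hlim.succ_lt (hlim.succ_lt hKκ)) hδ
      exact ⟨E, hE, hEF.mono fun t ht α hα => (ht α hα).le⟩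
  have hstabθ := hstab (isRegular_succ hcof.le) (lt_succ _) (hlim.succ_lt hθκ)
  have hinf : ℵ₀ ≤ Cardinal.lift.{u + 1} (succ κ.ord.cof) :=
    Cardinal.aleph0_le_lift.2 (hcof.le.trans (le_succ _))
  obtain ⟨g, hgH, hub, hg⟩ := exists_least_upper_bound (isRegular_succ hcof.le).lift
    (by rw [hιcard, Cardinal.lift_lt]; exact lt_succ _)
    (by rw [hLcof, Cardinal.lift_lt]; exact (hlim.succ_lt hθκ).trans (lt_succ _)) hf' hfH hstabθ
  have hb (j : Iio κ.ord.cof.ord) :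
      ∃ b, ∀ t, b ≤ t → Cardinal.lift.{u + 1} (lam j) ≤ Order.cof (Iio (g t)) := by
    have hmax : max κ.ord.cof (lam j) < κ := max_lt hθκ (hlam' j)
    have hinf' : ℵ₀ ≤ max κ.ord.cof (lam j) := hcof.le.trans (le_max_left _ _)
    -- K = (max θ λ_j)⁺ is regular, above θ and still below the limit κ.
    have := eventually_le_cof_least_upper_bound (K := Cardinal.lift.{u + 1} _)
      (Cardinal.aleph0_le_lift.2 (hinf'.trans (le_succ _))) hf hfH
      (hstab (isRegular_succ hinf') (lt_succ_of_le (le_max_left _ _)) (hlim.succ_lt hmax)) hub hg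
    obtain ⟨b, hb⟩ := eventually_atTop.1 this
    exact ⟨b, fun t ht => (Cardinal.lift_le.2 ((le_max_right _ _).trans (le_succ _))).trans
      (hb t ht)⟩
  choose b hb using hb
  -- Beyond t₀ one has λ_t > θ, which makes λ_t singular at limit t.
  obtain ⟨t₀, ht₀⟩ := hlam'' _ (hlim.succ_lt hθκ)
  refine ⟨_, isClub_closure_points (hιcard ▸ Cardinal.aleph0_lt_lift.2 hcof) b t₀, F, hF, fun h => ?_⟩
  let C := {t | t₀ < t ∧ IsSuccLimit t ∧ ∀ j < t, b j ≤ t}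
  have hgC {t : Iio κ.ord.cof.ord} (ht : t ∈ C) : H t ≤ g t := by
    refine succ_ord_le_of_le_cof hlam ht.2.1 ?_ fun j hj => hb j t (ht.2.2 j hj)
    rw [hιcard, Cardinal.lift_lt]
    exact (lt_succ _).trans_le (ht₀.trans (hlam.monotone ht.1.le))
  classical
  -- Off C, g may be smaller than λ_t⁺; the value 0 keeps h' below g there, since g is eventually
  -- positive.
  let h' (t : Iio κ.ord.cof.ord) : Ordinal.{u} := if t ∈ C then (h t).1 else 0
  have hh'g : ∀ᶠ t in atTop, h' t < g t := by
    obtain ⟨α, β, hαβ⟩ : ∃ α β : Iio (succ κ).ord, α < β :=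
      ⟨_, exists_gt ⟨0, ord_pos.2 (succ_pos _)⟩⟩
    filter_upwards [hf α β hαβ, hub β] with t h₁ h₂
    by_cases htC : t ∈ C
    · simpa only [h', if_pos htC] using (h t).2.trans_le (hgC htC)
    · simpa only [h', if_neg htC] using zero_le.trans_lt (h₁.trans_le h₂)
  have hh'H (t : Iio κ.ord.cof.ord) : h' t < H t := by
    by_cases htC : t ∈ C
    · simp only [h', if_pos htC]
      exact (h t).2
    · simpa only [h', if_neg htC] using ord_pos.2 (succ_pos (lam t))
  obtain ⟨α, hα⟩ := exists_lt_of_lt_least_upper_bound hinf hf' hfH hstabθ hub hg hh'g hh'H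
  refine ⟨α, hα.mono fun t ht htC => ?_⟩
  simpa only [h', if_pos (show t ∈ C from htC)] using! ht

/-! ### The filter of the statement -/

section Filters

variable {α : Type v} [LinearOrder α] [Nonempty α] [NoMaxOrder α]

theorem coboundedFilterWith_eq (C : Set α) : coboundedFilterWith C = atTop ⊓ 𝓟 C := by
  apply le_antisymm
  · refine le_inf (fun s hs => ?_) (le_principal_iff.2 (GenerateSets.basic (Or.inr rfl)))
    obtain ⟨a, ha⟩ := mem_atTop_sets.1 hs
    refine GenerateSets.basic (Or.inl ⟨a, fun b hb => ?_⟩)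
    by_contra! hab
    exact hb (ha b hab.le)
  · refine le_generate_iff.2 ?_
    rintro s (⟨a, ha⟩ | rfl)
    · refine mem_inf_of_left ((eventually_gt_atTop a).mono fun b hb => ?_)
      by_contra hbs
      exact (ha hbs).not_gt hb
    · exact mem_inf_of_right (mem_principal_self _)

/-- The generator C becomes trivial on C, so only tails remain. -/
theorem coboundedFilterOn_eq (C : Set α) :
    coboundedFilterOn C = (atTop : Filter α).comap Subtype.val := by
  rw [coboundedFilterOn, coboundedFilterWith_eq, comap_inf, comap_principal,
    Subtype.coe_preimage_self, principal_univ, inf_top_eq]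

theorem neBot_coboundedFilterOn {C : Set α} (hC : IsCofinal C) : (coboundedFilterOn C).NeBot := by
  rw [coboundedFilterOn_eq, comap_neBot_iff]
  intro s hs
  obtain ⟨a, ha⟩ := mem_atTop_sets.1 hs
  obtain ⟨c, hc, hac⟩ := hC a
  exact ⟨⟨c, hc⟩, ha c hac⟩

end Filters

end PCF

theorem mainTheorem8 (κ : Cardinal.{u}) (hκ : κ.IsSingular)
    (hcof : Cardinal.aleph0 < κ.ord.cof)
    (lam : Set.Iio κ.ord.cof.ord → Cardinal.{u})
    (hlam_normal : Order.IsNormal lam)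
    (hlam_lt : ∀ i, lam i < κ)
    (hlam_cofinal : ∀ μ < κ, ∃ i, μ ≤ lam i) :
    ∃ C : Set (Set.Iio κ.ord.cof.ord), IsClub C ∧
      PCF.HasTrueCofinality (PCF.coboundedFilterOn C)
        (fun i : C => Set.Iio (Order.succ (lam i)).ord) (Order.succ κ) := by
  classical
  obtain ⟨C, hC, F, hF, hFC⟩ :=
    PCF.exists_club_cofinal hκ hcof hlam_normal hlam_lt hlam_cofinal
  have hθ : κ.ord.cof.IsRegular := ⟨hcof.le, (Ordinal.cof_ord_cof _).ge⟩
  have hinf : Cardinal.aleph0 ≤ Order.cof (Set.Iio κ.ord.cof.ord) :=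
    PCF.cof_Iio_ord hθ ▸ Cardinal.aleph0_le_lift.2 hcof.le
  have := PCF.noMaxOrder_of_aleph0_le_cof hinf
  have := PCF.nonempty_of_aleph0_le_cof hinf
  refine ⟨C, hC, PCF.neBot_coboundedFilterOn hC.isCofinal, Cardinal.isRegular_succ hκ.aleph0_le,
    fun α => Quotient.mk _ fun i : C => F α i.1, fun α β hαβ => ?_, fun x => ?_⟩
  · change ∀ᶠ i : C in PCF.coboundedFilterOn C, F α i.1 < F β i.1
    rw [PCF.coboundedFilterOn_eq]
    exact (hF α β hαβ).comap _
  · induction x using Quotient.inductionOn with | h h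
    -- The default 0 off C is never compared.
    obtain ⟨α, hα⟩ := hFC fun t =>
      if ht : t ∈ C then h ⟨t, ht⟩ else ⟨0, Cardinal.ord_pos.2 (Cardinal.succ_pos _)⟩
    refine ⟨α, ?_⟩
    change ∀ᶠ i : C in PCF.coboundedFilterOn C, h i ≤ F α i.1
    rw [PCF.coboundedFilterOn_eq]
    filter_upwards [hα.comap _] with i hi
    simpa [i.2] using hi i.2
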